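/- All graphs are finite, undirected and simple. The clique-width of a graph is the minimum number of labels needed to construct it by the operations: creating a single vertex with label $i$; disjoint union of two labelled graphs; joining every vertex with label $i$ to every vertex with label $j$ (for $i\neq j$); renaming label $i$ to $j$. A graph is $H$-free if no induced subgraph of it is isomorphic to $H$. A split partition of a graph is a partition of its vertex set into a (possibly empty) clique $K$ and a (possibly empty) independent set $I$; a graph that has one is a split graph. Let $\mathrm{bull}+P_1$ be the disjoint union of an isolated vertex and the bull, the graph with vertices $a,b,c,d,e$ and edges $ab,bc,ca,ad,be$, and let $Q$ be the graph with vertices $a,b,c,d,e,f$ and edges $ab,bc,ca,ad,bd,be,cf$. A black-and-white labelling of a bipartite graph colours its vertices black and white such that both (possibly empty) colour classes are independent. For a bipartite graph $H$ with a fixed labelling $\ell$, a bipartite graph $G$ is weakly $H^{\ell}$-free if $G$ has a labelling for which there is no colour-preserving isomorphism of $H$ onto an induced subgraph of $G$. Let $b$ denote the labelling of $P_1+P_5$, respectively $P_2+P_4$, with the maximum number of black vertices (it is unique up to isomorphism). Theorem. The class of $(\mathrm{bull}+P_1)$-free split graphs and the class of $Q$-free split graphs have bounded clique-width, that is, for each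 of these two classes there is a constant $c$ such that every graph in the class has clique-width at most $c$. Moreover, let $G$ be a split graph with split partition $(K,I)$, and let $G'$ be the graph obtained from $G$ by complementing the subgraph induced by $K$ (that is, by removing all edges inside $K$). If $G$ is $(\mathrm{bull}+P_1)$-free, then $G'$ is a weakly $(P_1+P_5)^b$-free bipartite graph; if $G$ is $Q$-free, then $G'$ is a weakly $(P_2+P_4)^b$-free bipartite graph. -/

import Mathlib

universe u v

/-- Clique-width expressions over the label set `Fin k`: create a single vertex with label `i`;
disjoint union; join all vertices with label `i` to all vertices with label `j` (`i ≠ j`);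
rename label `i` to `j`. -/
inductive CWExpr (k : ℕ) : Type
  | vertex (i : Fin k) : CWExpr k
  | union (s t : CWExpr k) : CWExpr k
  | join (i j : Fin k) (hij : i ≠ j) (s : CWExpr k) : CWExpr k
  | rename (i j : Fin k) (s : CWExpr k) : CWExpr k

namespace CWExpr

/-- The vertex set of the graph built by an expression. -/
def Vert {k : ℕ} : CWExpr k → Type
  | vertex _ => Unit
  | union s t => s.Vert ⊕ t.Vert
  | join _ _ _ s => s.Vert
  | rename _ _ s => s.Vert

/-- The vertex labels of the labelled graph built by an expression. -/
def label {k : ℕ} : (s : CWExpr k) → s.Vert → Fin k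
  | vertex i => fun _ => i
  | union s t => Sum.elim s.label t.label
  | join _ _ _ s => s.label
  | rename i j s => fun x => if s.label x = i then j else s.label x

/-- The (unlabelled) graph built by an expression. -/
def graph {k : ℕ} : (s : CWExpr k) → SimpleGraph s.Vert
  | vertex _ => (⊥ : SimpleGraph Unit)
  | union s t => s.graph ⊕g t.graph
  | join i j _ s => s.graph ⊔ SimpleGraph.fromRel (fun x y => s.label x = i ∧ s.label y = j)
  | rename _ _ s => s.graph

end CWExpr

/-- `G` can be constructed with `k` labels. The graph without vertices needs no operation at
all, hence no labels. -/
def ConstructibleWithLabels {V : Type u} (G : SimpleGraph V) (k : ℕ) : Prop :=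
  IsEmpty V ∨ ∃ s : CWExpr k, Nonempty (s.graph ≃g G)

/-- The clique-width of `G`: the minimum number of labels with which `G` can be constructed
(`⊤` if there is no such number). -/
noncomputable def cliqueWidth {V : Type u} (G : SimpleGraph V) : ℕ∞ :=
  ⨅ (k : ℕ) (_ : ConstructibleWithLabels G k), (k : ℕ∞)

/-- A class `𝒢` of finite graphs has bounded clique-width. -/
def HasBoundedCliqueWidth (𝒢 : (V : Type u) → SimpleGraph V → Prop) : Prop :=
  ∃ c : ℕ, ∀ (V : Type u) [Finite V] (G : SimpleGraph V), 𝒢 V G → cliqueWidth G ≤ c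

/-- `(K, I)` is a split partition of `G`: the (possibly empty) sets `K` and `I` partition the
vertex set, `K` is a clique and `I` is an independent set. -/
def IsSplitPartition {V : Type u} (G : SimpleGraph V) (K I : Set V) : Prop :=
  IsCompl K I ∧ G.IsClique K ∧ G.IsIndepSet I

/-- `G` is a split graph. -/
def IsSplitGraph {V : Type u} (G : SimpleGraph V) : Prop :=
  ∃ K I : Set V, IsSplitPartition G K I

/-- `G` is `H`-free: no induced subgraph of `G` is isomorphic to `H`. -/
def IsInducedFree {W : Type v} {V : Type u} (H : SimpleGraph W) (G : SimpleGraph V) : Prop :=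
  ¬ H.IsIndContained G

/-- The bull: vertices `a, b, c, d, e = 0, 1, 2, 3, 4` and edges `ab, bc, ca, ad, be`. -/
def bull : SimpleGraph (Fin 5) :=
  SimpleGraph.fromEdgeSet {s(0, 1), s(1, 2), s(2, 0), s(0, 3), s(1, 4)}

/-- The graph `bull + P₁`. -/
def bullPlusP1 : SimpleGraph (Fin 5 ⊕ Fin 1) :=
  bull ⊕g SimpleGraph.pathGraph 1

/-- The graph `Q`: a triangle `0, 1, 2`, a vertex `3` adjacent to `0` and `1`, a vertex `4`
adjacent to `1`, and a vertex `5` adjacent to `2`. -/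
def graphQ : SimpleGraph (Fin 6) :=
  SimpleGraph.fromEdgeSet
    {s(0, 1), s(1, 2), s(2, 0), s(0, 3), s(1, 3), s(1, 4), s(2, 5)}

/-- The subgraph complementation of `G` with respect to the subgraph induced by `K`: edges
and non-edges between distinct vertices of `K` are exchanged. -/
def subgraphComplement {V : Type u} (G : SimpleGraph V) (K : Set V) : SimpleGraph V where
  Adj x y := x ≠ y ∧ ((x ∈ K ∧ y ∈ K ∧ ¬ G.Adj x y) ∨ (¬ (x ∈ K ∧ y ∈ K) ∧ G.Adj x y))
  symm := ⟨fun x y h => by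
    have := G.adj_comm x y
    tauto⟩
  loopless := ⟨fun x h => h.1 rfl⟩

/-- Black-and-white labellings of `G`, with `true` for black and `false` for white: both colour
classes are (possibly empty) independent sets. -/
abbrev BWLabelling {V : Type u} (G : SimpleGraph V) : Type u := G.Coloring Bool

/-- The labelled bipartite graph `H^ℓ` is (isomorphic to) a labelled induced subgraph
of `G^m`. -/
def IsLabelledIndContained {W : Type v} {V : Type u} {H : SimpleGraph W} (l : BWLabelling H)
    {G : SimpleGraph V} (m : BWLabelling G) : Prop :=
  ∃ f : H ↪g G, ∀ w, m (f w) = l w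

/-- `G` is weakly `H^ℓ`-free: some black-and-white labelling of `G` gives a labelled bipartite
graph that does not contain `H^ℓ` as a labelled induced subgraph. -/
def IsWeaklyFree {W : Type v} {V : Type u} {H : SimpleGraph W} (l : BWLabelling H)
    (G : SimpleGraph V) : Prop :=
  ∃ m : BWLabelling G, ¬ IsLabelledIndContained l m

/-- The number of black vertices of a labelling. -/
def numBlack {W : Type v} [Fintype W] {H : SimpleGraph W} (l : BWLabelling H) : ℕ :=
  (Finset.univ.filter (fun w => l w = true)).card

/-- Two labellings of the same graph are isomorphic. -/
def LabellingsIsomorphic {W : Type v} {H : SimpleGraph W} (l m : BWLabelling H) : Prop :=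
  ∃ f : H ≃g H, ∀ w, m (f w) = l w

/-- `b` is the labelling `b` of `H`, unique up to isomorphism: it maximizes the number of black
vertices, and all the labellings which do so are isomorphic to it. -/
def IsLabellingB {W : Type v} [Fintype W] {H : SimpleGraph W} (b : BWLabelling H) : Prop :=
  (∀ l : BWLabelling H, numBlack l ≤ numBlack b) ∧
    ∀ l : BWLabelling H, numBlack l = numBlack b → LabellingsIsomorphic l b

/-- The graph `P₁ + P₅`. -/
abbrev graphP1P5 : SimpleGraph (Fin 1 ⊕ Fin 5) :=
  SimpleGraph.pathGraph 1 ⊕g SimpleGraph.pathGraph 5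

/-- The graph `P₂ + P₄`. -/
abbrev graphP2P4 : SimpleGraph (Fin 2 ⊕ Fin 4) :=
  SimpleGraph.pathGraph 2 ⊕g SimpleGraph.pathGraph 4

/-- The labelling `b` of `P₁ + P₅`: black are the vertex of `P₁` and the end-vertices and the
middle vertex of `P₅`. -/
def labellingP1P5 : BWLabelling graphP1P5 :=
  SimpleGraph.Coloring.mk (Sum.elim ![true] ![true, false, true, false, true]) (by
    simp only [Sum.forall, Fin.forall_fin_succ]
    simp [SimpleGraph.pathGraph_adj])

/-- The labelling `b` of `P₂ + P₄`: on each of the two paths, black and white alternate. -/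
def labellingP2P4 : BWLabelling graphP2P4 :=
  SimpleGraph.Coloring.mk (Sum.elim ![true, false] ![true, false, true, false]) (by
    simp only [Sum.forall, Fin.forall_fin_succ]
    simp [SimpleGraph.pathGraph_adj])

theorem isLabellingB_labellingP1P5 : IsLabellingB labellingP1P5 := by
  have hb : numBlack labellingP1P5 = 4 := by rfl
  have key : ∀ l : BWLabelling graphP1P5, numBlack l ≤ 4 ∧
      (numBlack l = 4 → ∀ w, labellingP1P5 w = l w) := by
    intro l
    have h1 : l (.inr 0) ≠ l (.inr 1) := l.valid (by simp [SimpleGraph.pathGraph_adj])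
    have h2 : l (.inr 1) ≠ l (.inr 2) := l.valid (by simp [SimpleGraph.pathGraph_adj])
    have h3 : l (.inr 2) ≠ l (.inr 3) := l.valid (by simp [SimpleGraph.pathGraph_adj])
    have h4 : l (.inr 3) ≠ l (.inr 4) := l.valid (by simp [SimpleGraph.pathGraph_adj])
    have hn : numBlack l = (if l (.inl 0) then 1 else 0) + ((if l (.inr 0) then 1 else 0) +
        (if l (.inr 1) then 1 else 0) + (if l (.inr 2) then 1 else 0) +
        (if l (.inr 3) then 1 else 0) + (if l (.inr 4) then 1 else 0)) := by
      simp only [numBlack, Finset.card_filter, Fintype.sum_sum_type, Fin.sum_univ_five,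
        Fin.sum_univ_one]
    rw [hn]
    have hv : ∀ w, labellingP1P5 w =
        Sum.elim ![true] ![true, false, true, false, true] w := fun _ => rfl
    simp only [hv, Sum.forall, Fin.forall_fin_succ]
    simp only [Fin.succ]
    generalize l (.inl 0) = a at *
    cases a <;> cases h0 : l (.inr 0) <;> simp_all
  refine ⟨fun l => hb ▸ (key l).1, fun l hl => ⟨SimpleGraph.Iso.refl, ?_⟩⟩
  exact (key l).2 (hl.trans hb)

theorem isLabellingB_labellingP2P4 : IsLabellingB labellingP2P4 := by
  have hn : ∀ l : BWLabelling graphP2P4, numBlack l =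
      ((if l (.inl 0) then 1 else 0) + (if l (.inl 1) then 1 else 0)) +
      ((if l (.inr 0) then 1 else 0) + (if l (.inr 1) then 1 else 0) +
        (if l (.inr 2) then 1 else 0) + (if l (.inr 3) then 1 else 0)) := by
    intro l
    simp only [numBlack, Finset.card_filter, Fintype.sum_sum_type, Fin.sum_univ_four,
      Fin.sum_univ_two]
  have hrev : ∀ n : ℕ, ∀ x y : Fin n, (SimpleGraph.pathGraph n).Adj x.rev y.rev ↔
      (SimpleGraph.pathGraph n).Adj x y := by
    intro n x y
    simp only [SimpleGraph.pathGraph_adj, Fin.val_rev]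
    omega
  let e (n : ℕ) (p : Bool) : SimpleGraph.pathGraph n ≃g SimpleGraph.pathGraph n :=
    if p then SimpleGraph.Iso.refl else ⟨Fin.revPerm, fun {x y} => hrev n x y⟩
  let f (p q : Bool) : graphP2P4 ≃g graphP2P4 :=
    ⟨Equiv.sumCongr (e 2 p).toEquiv (e 4 q).toEquiv, by
      rintro (x | x) (y | y)
      · exact (e 2 p).map_rel_iff
      · exact Iff.rfl
      · exact Iff.rfl
      · exact (e 4 q).map_rel_iff⟩
  have hf : ∀ p q, ∀ w, f p q w = Sum.map (if p then id else Fin.rev)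
      (if q then id else Fin.rev) w := by
    intro p q w
    cases p <;> cases q <;> rcases w with w | w <;> rfl
  have hv : ∀ w, labellingP2P4 w =
      Sum.elim ![true, false] ![true, false, true, false] w := fun _ => rfl
  have key : ∀ l : BWLabelling graphP2P4, numBlack l = 3 ∧
      ∀ w, labellingP2P4 (f (l (.inl 0)) (l (.inr 0)) w) = l w := by
    intro l
    have h0 : l (.inl 0) ≠ l (.inl 1) := l.valid (by simp [SimpleGraph.pathGraph_adj])
    have h1 : l (.inr 0) ≠ l (.inr 1) := l.valid (by simp [SimpleGraph.pathGraph_adj])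
    have h2 : l (.inr 1) ≠ l (.inr 2) := l.valid (by simp [SimpleGraph.pathGraph_adj])
    have h3 : l (.inr 2) ≠ l (.inr 3) := l.valid (by simp [SimpleGraph.pathGraph_adj])
    rw [hn]
    simp only [hf, hv, Sum.forall, Fin.forall_fin_succ]
    simp only [Fin.succ]
    cases ha : l (.inl 0) <;> cases hc : l (.inr 0) <;> simp_all [Fin.rev]
  exact ⟨fun l => by rw [(key l).1, (key labellingP2P4).1], fun l _ => ⟨_, (key l).2⟩⟩

/-- The graph `H` with vertex labelling `l` is built by an expression over `Fin n`. -/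
def IsBuilt (n : ℕ) {W : Type u} (H : SimpleGraph W) (l : W → Fin n) : Prop :=
  ∃ (s : CWExpr n) (e : s.graph ≃g H), ∀ x, s.label x = l (e x)

namespace IsBuilt

variable {n : ℕ} {W : Type u} {H : SimpleGraph W} {l : W → Fin n}

theorem congr_iso {W' : Type v} {H' : SimpleGraph W'} (h : IsBuilt n H l) (f : H ≃g H')
    {l' : W' → Fin n} (hl : ∀ x, l' (f x) = l x) : IsBuilt n H' l' := by
  obtain ⟨s, e, he⟩ := h
  exact ⟨s, e.trans f, fun x => (he x).trans (hl (e x)).symm⟩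

theorem vertex [Unique W] (H : SimpleGraph W) (l : W → Fin n) : IsBuilt n H l := by
  refine ⟨.vertex (l default), ⟨Equiv.ofUnique Unit W, ?_⟩, ?_⟩
  · intro a b
    have h1 : (Equiv.ofUnique Unit W) a = (Equiv.ofUnique Unit W) b := Subsingleton.elim _ _
    have h2 : a = b := Subsingleton.elim (α := Unit) a b
    subst h2
    exact iff_of_false (SimpleGraph.irrefl _) (SimpleGraph.irrefl _)
  · intro x
    exact congrArg l (Subsingleton.elim _ _)

theorem union {W' : Type u} {H' : SimpleGraph W'} {l' : W' → Fin n} (h : IsBuilt n H l)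
    (h' : IsBuilt n H' l') : IsBuilt n (H ⊕g H') (Sum.elim l l') := by
  obtain ⟨s, e, he⟩ := h
  obtain ⟨s', e', he'⟩ := h'
  refine ⟨.union s s', ⟨Equiv.sumCongr e.toEquiv e'.toEquiv, ?_⟩, ?_⟩
  · rintro (a | a) (b | b)
    · exact e.map_rel_iff
    · exact Iff.rfl
    · exact Iff.rfl
    · exact e'.map_rel_iff
  · rintro (a | a)
    · exact he a
    · exact he' a

theorem join (h : IsBuilt n H l) {i j : Fin n} (hij : i ≠ j) :
    IsBuilt n (H ⊔ SimpleGraph.fromRel (fun x y => l x = i ∧ l y = j)) l := by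
  obtain ⟨s, e, he⟩ := h
  refine ⟨.join i j hij s, ⟨e.toEquiv, ?_⟩, he⟩
  intro a b
  change (_ ∨ _) ↔ (_ ∨ _)
  refine or_congr e.map_rel_iff ?_
  rw [SimpleGraph.fromRel_adj, SimpleGraph.fromRel_adj, he a, he b]
  exact and_congr_left' (not_congr e.toEquiv.injective.eq_iff)

theorem rename (h : IsBuilt n H l) (i j : Fin n) :
    IsBuilt n H (fun x => if l x = i then j else l x) := by
  obtain ⟨s, e, he⟩ := h
  refine ⟨.rename i j s, e, fun x => ?_⟩
  change (if s.label x = i then j else s.label x) = _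
  rw [he x]
  rfl

/-- Sequential renaming along an injective family of labels, disjoint from the targets. -/
theorem rename_family (h : IsBuilt n H l) {k : ℕ} (p q : Fin k → Fin n)
    (hp : Function.Injective p) (hpq : ∀ i j, p i ≠ q j) (t : Finset (Fin k)) :
    ∀ l' : W → Fin n, (∀ x, (∃ i ∈ t, l x = p i ∧ l' x = q i) ∨
      ((∀ i ∈ t, l x ≠ p i) ∧ l' x = l x)) → IsBuilt n H l' := by
  induction t using Finset.induction_on with
  | empty =>
    intro l' hl'
    have : l' = l := funext fun x => by simpa using hl' x
    exact this ▸ h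
  | insert a t ha ih =>
    intro l' hl'
    have h1 := (ih (fun x => if l x = p a then p a else l' x) (fun x => by
      by_cases hx : l x = p a
      · right
        refine ⟨fun i hi hi' => ha ?_, by simp [hx]⟩
        rwa [hp (hx.symm.trans hi')]
      · simp only [hx, if_false]
        rcases hl' x with ⟨i, hi, h2, h3⟩ | ⟨h2, h3⟩
        · left
          refine ⟨i, (Finset.mem_insert.1 hi).resolve_left ?_, h2, h3⟩
          rintro rfl
          exact hx h2
        · right
          exact ⟨fun i hi => h2 i (Finset.mem_insert_of_mem hi), h3⟩)).rename (p a) (q a)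
    convert h1 using 2 with x
    by_cases hx : l x = p a
    · simp only [hx, if_true]
      rcases hl' x with ⟨i, hi, h2, h3⟩ | ⟨h2, h3⟩
      · rw [h3, hp (hx.symm.trans h2)]
      · exact absurd hx (h2 a (Finset.mem_insert_self _ _))
    · simp only [hx, if_false]
      rw [if_neg]
      rcases hl' x with ⟨i, hi, h2, h3⟩ | ⟨h2, h3⟩
      · rw [h3]
        exact (hpq a i).symm
      · rwa [h3]

/-- Sequential joins along a finite set of pairs of distinct labels. -/
theorem join_family (h : IsBuilt n H l) (t : Finset (Fin n × Fin n)) :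
    (∀ z ∈ t, z.1 ≠ z.2) → ∀ H' : SimpleGraph W,
      (∀ x y, H'.Adj x y ↔ H.Adj x y ∨ (l x, l y) ∈ t ∨ (l y, l x) ∈ t) → IsBuilt n H' l := by
  induction t using Finset.induction_on with
  | empty =>
    intro _ H' hH
    have : H' = H := by
      ext x y
      simp [hH]
    exact this ▸ h
  | insert a t ha ih =>
    intro ht H' hH
    have hne : ∀ x y, (l x, l y) ∈ insert a t → x ≠ y := by
      rintro x y hxy rfl
      exact ht _ hxy rfl
    have h1 := (ih (fun z hz => ht z (Finset.mem_insert_of_mem hz))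
      (H ⊔ SimpleGraph.fromRel (fun x y => (l x, l y) ∈ t)) (fun x y => by
        simp only [SimpleGraph.sup_adj, SimpleGraph.fromRel_adj]
        have h1 : (l x, l y) ∈ t → x ≠ y := fun h => hne x y (Finset.mem_insert_of_mem h)
        have h2 : (l y, l x) ∈ t → x ≠ y := fun h => (hne y x (Finset.mem_insert_of_mem h)).symm
        tauto)).join (ht a (Finset.mem_insert_self _ _))
    convert h1 using 1
    ext x y
    simp only [hH, SimpleGraph.sup_adj, SimpleGraph.fromRel_adj]
    have h1 := hne x y
    have h2 : (l y, l x) ∈ insert a t → x ≠ y := fun h => (hne y x h).symm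
    have h3 : ∀ b c : Fin n, (b, c) ∈ insert a t ↔ (b = a.1 ∧ c = a.2) ∨ (b, c) ∈ t := by
      intro b c
      rw [Finset.mem_insert, Prod.ext_iff]
    rw [h3] at h1 h2
    rw [h3, h3]
    tauto

end IsBuilt

/-- `U` is the disjoint union of two nonempty parts such that adjacency between the parts only
depends on the colours of the end-vertices. -/
def HasColourSplit {V : Type u} {k : ℕ} (G : SimpleGraph V) (c : V → Fin k) (U : Set V) : Prop :=
  ∃ A B : Set V, A.Nonempty ∧ B.Nonempty ∧ Disjoint A B ∧ A ∪ B = U ∧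
    ∃ J : Fin k → Fin k → Prop, ∀ x ∈ A, ∀ y ∈ B, G.Adj x y ↔ J (c x) (c y)

theorem isBuilt_induce {V : Type u} [Finite V] {k : ℕ} (G : SimpleGraph V) (c : V → Fin k)
    (h : ∀ U : Set V, U.Nontrivial → HasColourSplit G c U) (m : ℕ) :
    ∀ U : Set V, U.ncard = m → U.Nonempty →
      IsBuilt (k + k) (G.induce U) (fun x => Fin.castAdd k (c x)) := by
  classical
  induction m using Nat.strong_induction_on with
  | _ m ih =>
  intro U hm hU
  rcases hU.exists_eq_singleton_or_nontrivial with ⟨x, rfl⟩ | hU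
  · exact IsBuilt.vertex _ _
  obtain ⟨A, B, hA, hB, hAB, rfl, J, hJ⟩ := h U hU
  have hc := Set.ncard_union_eq hAB
  have hA0 := hA.ncard_pos
  have hB0 := hB.ncard_pos
  have bA := ih A.ncard (by omega) A rfl hA
  have bB := (ih B.ncard (by omega) B rfl hB).rename_family (Fin.castAdd k) (Fin.natAdd k)
    (Fin.castAdd_injective k k) (fun i j hij => by
      have := congrArg Fin.val hij
      simp only [Fin.val_castAdd, Fin.val_natAdd] at this
      omega) Finset.univ (fun x => Fin.natAdd k (c x))
    (fun x => .inl ⟨c x, Finset.mem_univ _, rfl, rfl⟩)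
  have hcn : ∀ i j : Fin k, Fin.castAdd k i ≠ Fin.natAdd k j := fun i j hij => by
    have := congrArg Fin.val hij
    simp only [Fin.val_castAdd, Fin.val_natAdd] at this
    omega
  have hnc : ∀ i j : Fin k, Fin.natAdd k i ≠ Fin.castAdd k j := fun i j => (hcn j i).symm
  have hci : ∀ i j : Fin k, Fin.castAdd k i = Fin.castAdd k j ↔ i = j :=
    fun i j => (Fin.castAdd_injective k k).eq_iff
  have hni : ∀ i j : Fin k, Fin.natAdd k i = Fin.natAdd k j ↔ i = j :=
    fun i j => (Fin.natAdd_injective k k).eq_iff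
  have b1 := (bA.union bB).join_family
    ((Finset.univ.filter (fun z : Fin k × Fin k => J z.1 z.2)).image
      (fun z => (Fin.castAdd k z.1, Fin.natAdd k z.2)))
    (by
      intro z hz
      obtain ⟨w, -, rfl⟩ := Finset.mem_image.1 hz
      exact hcn _ _)
    (G.comap (Sum.elim Subtype.val Subtype.val : A ⊕ B → V)) (by
      rintro (⟨x, hx⟩ | ⟨x, hx⟩) (⟨y, hy⟩ | ⟨y, hy⟩)
      · simp [-Fin.natAdd_eq_addNat, hnc]
      · simp [-Fin.natAdd_eq_addNat, hnc, hci, hni, hJ x hx y hy]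
      · simp [-Fin.natAdd_eq_addNat, hnc, hci, hni, G.adj_comm x y, hJ y hy x hx]
      · simp [-Fin.natAdd_eq_addNat, hcn])
  have b2 := b1.rename_family (Fin.natAdd k) (Fin.castAdd k) (Fin.natAdd_injective k k)
    (fun i j => (hcn j i).symm) Finset.univ
    (fun x => Fin.castAdd k (c (Sum.elim Subtype.val Subtype.val x))) (by
      rintro (⟨x, hx⟩ | ⟨x, hx⟩)
      · right
        simp [-Fin.natAdd_eq_addNat, hcn]
      · left
        simp)
  refine b2.congr_iso (H' := G.induce (A ∪ B)) ⟨(Equiv.Set.union hAB).symm, ?_⟩ ?_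
  · rintro (⟨x, hx⟩ | ⟨x, hx⟩) (⟨y, hy⟩ | ⟨y, hy⟩) <;> simp
  · rintro (⟨x, hx⟩ | ⟨x, hx⟩) <;> simp

theorem cliqueWidth_le_of_hasColourSplit {V : Type u} [Finite V] {k : ℕ} (G : SimpleGraph V)
    (c : V → Fin k) (h : ∀ U : Set V, U.Nontrivial → HasColourSplit G c U) :
    cliqueWidth G ≤ (k + k : ℕ) := by
  refine iInf₂_le (k + k) ?_
  rcases isEmpty_or_nonempty V with hV | hV
  · exact .inl hV
  · obtain ⟨s, e, -⟩ := isBuilt_induce G c h _ Set.univ rfl Set.univ_nonempty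
    exact .inr ⟨s, ⟨e.trans (SimpleGraph.induceUnivIso G)⟩⟩

/-- The bipartite graph with adjacency `R` contains an induced path on six vertices. -/
def HasInducedP6 {α : Type u} {β : Type v} (R : α → β → Prop) : Prop :=
  ∃ a₁ a₂ a₃ b₁ b₂ b₃, R a₁ b₁ ∧ R a₂ b₁ ∧ R a₂ b₂ ∧ R a₃ b₂ ∧ R a₃ b₃ ∧
    ¬ R a₁ b₂ ∧ ¬ R a₁ b₃ ∧ ¬ R a₂ b₃ ∧ ¬ R a₃ b₁

/-- The vertices of the bipartite graph with adjacency `R` can be partitioned into two nonempty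
parts `A ∪ B` and `Aᶜ ∪ Bᶜ` such that `A` and `Bᶜ`, as well as `Aᶜ` and `B`, are
complete or anticomplete to each other. -/
def HasUniformSplit {α : Type u} {β : Type v} (R : α → β → Prop) : Prop :=
  ∃ (A : Set α) (B : Set β), (A.Nonempty ∨ B.Nonempty) ∧ (Aᶜ.Nonempty ∨ Bᶜ.Nonempty) ∧
    ∃ p q : Prop, (∀ a ∈ A, ∀ b ∉ B, R a b ↔ p) ∧ (∀ a ∉ A, ∀ b ∈ B, R a b ↔ q)

section

variable {α : Type u} {β : Type v} {R : α → β → Prop}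

theorem HasInducedP6.flip (h : HasInducedP6 (flip R)) : HasInducedP6 R := by
  obtain ⟨a₁, a₂, a₃, b₁, b₂, b₃, h⟩ := h
  simp only [_root_.flip] at h
  exact ⟨b₃, b₂, b₁, a₃, a₂, a₁, by tauto⟩

theorem HasUniformSplit.flip (h : HasUniformSplit (flip R)) : HasUniformSplit R := by
  obtain ⟨A, B, h1, h2, p, q, h3, h4⟩ := h
  exact ⟨B, A, h1.symm, h2.symm, q, p, fun a ha b hb => h4 b hb a ha,
    fun a ha b hb => h3 b hb a ha⟩

/-- `a₁, a₂, a₃, b₁, b₂, b₃` induce a six-cycle: the non-adjacent pairs are `aᵢ, bᵢ`. -/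
def IsInducedC6 (R : α → β → Prop) (a₁ a₂ a₃ : α) (b₁ b₂ b₃ : β) : Prop :=
  (¬ R a₁ b₁ ∧ ¬ R a₂ b₂ ∧ ¬ R a₃ b₃) ∧ (R a₁ b₂ ∧ R a₁ b₃) ∧ (R a₂ b₁ ∧ R a₂ b₃) ∧
    (R a₃ b₁ ∧ R a₃ b₂)

variable {a₁ a₂ a₃ : α} {b₁ b₂ b₃ : β}

theorem IsInducedC6.flip (h : IsInducedC6 R a₁ a₂ a₃ b₁ b₂ b₃) :
    IsInducedC6 (flip R) b₁ b₂ b₃ a₁ a₂ a₃ := by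
  simp only [IsInducedC6, _root_.flip] at *
  tauto

theorem IsInducedC6.rotate (h : IsInducedC6 R a₁ a₂ a₃ b₁ b₂ b₃) :
    IsInducedC6 R a₂ a₃ a₁ b₂ b₃ b₁ := by
  simp only [IsInducedC6] at *
  tauto

theorem IsInducedC6.not_adj_of_not_adj (h : IsInducedC6 R a₁ a₂ a₃ b₁ b₂ b₃)
    (h6 : ¬ HasInducedP6 R) {y : β} (h2 : ¬ R a₂ y) (h3 : ¬ R a₃ y) : ¬ R a₁ y := by
  intro h1
  obtain ⟨⟨h11, h22, h33⟩, ⟨h12, h13⟩, ⟨h21, h23⟩, ⟨h31, h32⟩⟩ := h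
  exact h6 ⟨a₃, a₂, a₁, b₁, b₃, y, h31, h21, h23, h13, h1, h33, h3, h2, h11⟩

theorem IsInducedC6.not_adj_of_not_adj' (h : IsInducedC6 R a₁ a₂ a₃ b₁ b₂ b₃)
    (h6 : ¬ HasInducedP6 R) {x : α} (h2 : ¬ R x b₂) (h3 : ¬ R x b₃) : ¬ R x b₁ :=
  h.flip.not_adj_of_not_adj (fun h => h6 h.flip) h2 h3

/-- A partition witnessing that the bipartite complement is disconnected after deleting
the vertex `a`. -/
def IsComplCut (R : α → β → Prop) (a : α) : Prop :=
  ∃ (A : Set α) (B : Set β), ((∃ x ∈ A, x ≠ a) ∨ B.Nonempty) ∧ ((∃ x ∉ A, x ≠ a) ∨ Bᶜ.Nonempty) ∧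
    (∀ x ∈ A, x ≠ a → ∀ y ∉ B, R x y) ∧ (∀ x ∉ A, x ≠ a → ∀ y ∈ B, R x y)

theorem IsInducedC6.split_of_split_delete (h : IsInducedC6 R a₁ a₂ a₃ b₁ b₂ b₃)
    (h6 : ¬ HasInducedP6 R)
    (hs : HasUniformSplit (fun (x : {x : α // x ≠ a₁}) (y : β) => R x y)) :
    HasUniformSplit R ∨ IsComplCut R a₁ := by
  by_cases hcut : IsComplCut R a₁
  · exact .inr hcut
  left
  have hh := h
  obtain ⟨⟨h11, h22, h33⟩, ⟨h12, h13⟩, ⟨h21, h23⟩, ⟨h31, h32⟩⟩ := hh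
  have n21 : a₂ ≠ a₁ := by
    rintro rfl
    exact h11 h21
  have n31 : a₃ ≠ a₁ := by
    rintro rfl
    exact h11 h31
  have key : ∀ (A : Set α) (B : Set β), a₂ ∈ A → ((∃ x ∉ A, x ≠ a₁) ∨ Bᶜ.Nonempty) →
      ∀ p q : Prop, (∀ x ∈ A, x ≠ a₁ → ∀ y ∉ B, R x y ↔ p) →
        (∀ x ∉ A, x ≠ a₁ → ∀ y ∈ B, R x y ↔ q) → HasUniformSplit R := by
    intro A B ha2 hne p q hp hq
    have hpq : ¬ (p ∧ q) := fun hpq => hcut ⟨A, B, .inl ⟨a₂, ha2, n21⟩, hne,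
      fun x hx hx' y hy => (hp x hx hx' y hy).2 hpq.1,
      fun x hx hx' y hy => (hq x hx hx' y hy).2 hpq.2⟩
    have p2 := hp a₂ ha2 n21
    by_cases ha3 : a₃ ∈ A
    · have p3 := hp a₃ ha3 n31
      have hb2 : b₂ ∈ B := by
        by_contra hb
        exact h22 (((p2 _ hb).trans (p3 _ hb).symm).2 h32)
      have hb3 : b₃ ∈ B := by
        by_contra hb
        exact h33 (((p2 _ hb).trans (p3 _ hb).symm).1 h23)
      by_cases hpp : p
      · have hqq : ¬ q := fun hqq => hpq ⟨hpp, hqq⟩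
        have hA : ∃ x ∉ A, x ≠ a₁ := by
          by_contra hA
          push Not at hA
          refine hcut ⟨A, B, .inl ⟨a₂, ha2, n21⟩, hne, fun x hx hx' y hy =>
            (hp x hx hx' y hy).2 hpp, fun x hx hx' => absurd (hA x hx) hx'⟩
        obtain ⟨x₀, hx₀, hx₀'⟩ := hA
        refine ⟨insert a₁ A, {y | R a₁ y → y ∈ B}, .inl ⟨a₂, .inr ha2⟩,
          .inl ⟨x₀, ?_⟩, True, False, ?_, ?_⟩
        · simp [hx₀, hx₀']
        · rintro x hx y hy
          simp only [Set.mem_ofPred_eq, Classical.not_imp] at hy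
          simp only [iff_true]
          rcases eq_or_ne x a₁ with rfl | hx'
          · exact hy.1
          · exact (hp x (hx.resolve_left hx') hx' y hy.2).2 hpp
        · intro x hx y hy
          simp only [Set.mem_insert_iff, not_or] at hx
          simp only [Set.mem_ofPred_eq] at hy
          simp only [iff_false]
          have r2 : ¬ R x b₂ := fun hr => hqq ((hq x hx.2 hx.1 _ hb2).1 hr)
          have r3 : ¬ R x b₃ := fun hr => hqq ((hq x hx.2 hx.1 _ hb3).1 hr)
          by_cases hyB : y ∈ B
          · exact fun hr => hqq ((hq x hx.2 hx.1 _ hyB).1 hr)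
          · have hc : IsInducedC6 R a₁ a₂ a₃ y b₂ b₃ :=
              ⟨⟨fun hr => hyB (hy hr), h22, h33⟩, ⟨h12, h13⟩, ⟨(p2 y hyB).2 hpp, h23⟩,
                ⟨(p3 y hyB).2 hpp, h32⟩⟩
            exact hc.not_adj_of_not_adj' h6 r2 r3
      · refine ⟨insert a₁ A, B, .inl ⟨a₂, .inr ha2⟩, ?_, False, q, ?_, ?_⟩
        · rcases hne with ⟨x, hx, hx'⟩ | hne
          · exact .inl ⟨x, by simp [hx, hx']⟩
          · exact .inr hne
        · intro x hx y hy
          simp only [iff_false]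
          rcases eq_or_ne x a₁ with rfl | hx'
          · exact h.not_adj_of_not_adj h6 (fun hr => hpp ((p2 y hy).1 hr))
              (fun hr => hpp ((p3 y hy).1 hr))
          · exact fun hr => hpp ((hp x (hx.resolve_left hx') hx' y hy).1 hr)
        · intro x hx y hy
          simp only [Set.mem_insert_iff, not_or] at hx
          exact hq x hx.2 hx.1 y hy
    · exfalso
      have q3 := hq a₃ ha3 n31
      have hb2 : b₂ ∈ B := by
        by_contra hb
        have np : ¬ p := fun hp' => h22 ((p2 _ hb).2 hp')
        have hb1 : b₁ ∈ B := by
          by_contra hb'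
          exact np ((p2 _ hb').1 h21)
        have hb3 : b₃ ∈ B := by
          by_contra hb'
          exact np ((p2 _ hb').1 h23)
        exact h33 ((q3 _ hb3).2 ((q3 _ hb1).1 h31))
      have hq' : q := (q3 _ hb2).1 h32
      have hb3 : b₃ ∉ B := fun hb => h33 ((q3 _ hb).2 hq')
      exact hpq ⟨(p2 _ hb3).1 h23, hq'⟩
  obtain ⟨A, B, hn1, hn2, p, q, hp, hq⟩ := hs
  by_cases ha2 : (⟨a₂, n21⟩ : {x : α // x ≠ a₁}) ∈ A
  · refine key {x | ∃ hx : x ≠ a₁, ⟨x, hx⟩ ∈ A} B ⟨n21, ha2⟩ ?_ p q ?_ ?_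
    · rcases hn2 with ⟨⟨x, hx⟩, hx'⟩ | hn2
      · exact .inl ⟨x, fun ⟨_, h⟩ => hx' h, hx⟩
      · exact .inr hn2
    · rintro x ⟨hx, hxA⟩ - y hy
      exact hp _ hxA y hy
    · intro x hxA hx y hy
      exact hq ⟨x, hx⟩ (fun h => hxA ⟨hx, h⟩) y hy
  · refine key {x | ∃ hx : x ≠ a₁, ⟨x, hx⟩ ∉ A} Bᶜ ⟨n21, ha2⟩ ?_ q p ?_ ?_
    · rcases hn1 with ⟨⟨x, hx⟩, hx'⟩ | hn1
      · exact .inl ⟨x, fun ⟨_, h⟩ => h hx', hx⟩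
      · exact .inr (by simpa using hn1)
    · rintro x ⟨hx, hxA⟩ - y hy
      exact hq _ hxA y (by simpa using hy)
    · intro x hxA hx y hy
      exact hp ⟨x, hx⟩ (by
        by_contra h
        exact hxA ⟨hx, h⟩) y hy

/-- A vertex whose neighbourhood is everything or nothing can be split off. -/
theorem hasUniformSplit_of_vertex (b : β) (hne : Nonempty α ∨ ∃ b', b' ≠ b) (p : Prop)
    (h : ∀ a, R a b ↔ p) : HasUniformSplit R := by
  refine ⟨∅, {b}, .inr ⟨b, rfl⟩, ?_, True, p, by simp, ?_⟩
  · rcases hne with ⟨⟨a⟩⟩ | ⟨b', hb'⟩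
    · exact .inl ⟨a, by simp⟩
    · exact .inr ⟨b', hb'⟩
  · rintro a - _ rfl
    exact h a

/-- A vertex which is complete to `b₁, b₂, b₃` in the complement rules out two cut vertices
`b₁, b₂` of the bipartite complement. -/
theorem IsInducedC6.split_of_cuts (h : IsInducedC6 R a₁ a₂ a₃ b₁ b₂ b₃)
    (h6 : ¬ HasInducedP6 R) {y : β} (y1 : ¬ R a₁ y) (y2 : ¬ R a₂ y) (y3 : ¬ R a₃ y)
    (hc1 : IsComplCut (_root_.flip R) b₁) (hc2 : IsComplCut (_root_.flip R) b₂) : HasUniformSplit R := by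
  by_contra hns
  have iso1 : ∀ a, ∃ b, ¬ R a b := by
    intro a
    by_contra! hall
    exact hns (HasUniformSplit.flip (hasUniformSplit_of_vertex (R := _root_.flip R) a
      (.inl ⟨b₁⟩) True (fun b => by simpa [_root_.flip] using hall b)))
  have iso2 : ∀ b, ∃ a, ¬ R a b := by
    intro b
    by_contra! hall
    exact hns (hasUniformSplit_of_vertex b (.inl ⟨a₁⟩) True (fun a => by simpa using hall a))
  have pendant : ∀ {a₁ a₂ a₃ : α} {b₁ b₂ b₃ : β}, IsInducedC6 R a₁ a₂ a₃ b₁ b₂ b₃ → ¬ R a₁ y →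
      ¬ R a₂ y → ¬ R a₃ y → IsComplCut (_root_.flip R) b₁ → ∃ d, ¬ R d b₁ ∧ ∀ b, b ≠ b₁ → R d b := by
    intro a₁ a₂ a₃ b₁ b₂ b₃ h y1 y2 y3 hc
    obtain ⟨⟨h11, h22, h33⟩, ⟨h12, h13⟩, ⟨h21, h23⟩, ⟨h31, h32⟩⟩ := h
    have ny : y ≠ b₁ := by
      rintro rfl
      exact y2 h21
    have n2 : b₂ ≠ b₁ := by
      rintro rfl
      exact h11 h12
    have n3 : b₃ ≠ b₁ := by
      rintro rfl
      exact h11 h13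
    have key : ∀ (B : Set β) (A : Set α), y ∉ B → ((∃ b ∈ B, b ≠ b₁) ∨ A.Nonempty) →
        (∀ b ∈ B, b ≠ b₁ → ∀ a ∉ A, R a b) → (∀ b ∉ B, b ≠ b₁ → ∀ a ∈ A, R a b) →
        ∃ d, ¬ R d b₁ ∧ ∀ b, b ≠ b₁ → R d b := by
      intro B A hy hne hB hA
      have hA' : ∀ a, ¬ R a y → a ∉ A := fun a ha ha' => ha (hA y hy ny a ha')
      have hb2 : b₂ ∉ B := fun hb => h22 (hB _ hb n2 _ (hA' _ y2))
      have hb3 : b₃ ∉ B := fun hb => h33 (hB _ hb n3 _ (hA' _ y3))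
      have hedge : ∀ a ∈ A, ∀ b ∈ B, b ≠ b₁ → R a b := by
        intro a ha b hb hb'
        by_contra hr
        have e1 := hA _ hb2 n2 _ ha
        have e2 := hA _ hy ny _ ha
        have e3 := hB _ hb hb' _ (hA' _ y2)
        have e4 := hB _ hb hb' _ (hA' _ y3)
        exact h6 ⟨a₂, a₃, a, b, b₂, y, e3, e4, h32, e1, e2, h22, y2, y3, hr⟩
      have hA0 : A.Nonempty := by
        rcases hne with ⟨b, hb, hb'⟩ | hne
        · obtain ⟨a, ha⟩ := iso2 b
          by_contra hA0
          rw [Set.not_nonempty_iff_eq_empty] at hA0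
          exact ha (hB b hb hb' a (by simp [hA0]))
        · exact hne
      obtain ⟨d, hd⟩ := hA0
      have hd' : ∀ b, b ≠ b₁ → R d b := by
        intro b hb
        by_cases hbB : b ∈ B
        · exact hedge d hd b hbB hb
        · exact hA b hbB hb d hd
      obtain ⟨b, hb⟩ := iso1 d
      have : b = b₁ := by
        by_contra hne
        exact hb (hd' b hne)
      exact ⟨d, this ▸ hb, hd'⟩
    obtain ⟨B, A, hn1, hn2, hB, hA⟩ := hc
    by_cases hy : y ∈ B
    · exact key Bᶜ Aᶜ (by simpa using hy) hn2
        (fun b hb hb' a ha => hA b hb hb' a (by simpa using ha))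
        (fun b hb hb' a ha => hB b (by simpa using hb) hb' a ha)
    · exact key B A hy hn1 hB hA
  obtain ⟨d₁, hd1, hd1'⟩ := pendant h y1 y2 y3 hc1
  obtain ⟨d₂, hd2, hd2'⟩ := pendant h.rotate y2 y3 y1 hc2
  obtain ⟨⟨h11, h22, h33⟩, ⟨h12, h13⟩, ⟨h21, h23⟩, ⟨h31, h32⟩⟩ := h
  have n2 : b₂ ≠ b₁ := by
    rintro rfl
    exact h11 h12
  have ny1 : y ≠ b₁ := by
    rintro rfl
    exact y2 h21
  have ny2 : y ≠ b₂ := by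
    rintro rfl
    exact y1 h12
  exact h6 ⟨a₂, d₂, d₁, b₁, y, b₂, h21, hd2' _ n2.symm, hd2' _ ny2, hd1' _ ny1, hd1' _ n2, y2,
    h22, hd2, hd1⟩

theorem IsInducedC6.adj_of_adj (h : IsInducedC6 R a₁ a₂ a₃ b₁ b₂ b₃) (h6 : ¬ HasInducedP6 R)
    {x : α} {y : β} (hx0 : R x b₁ ∨ R x b₂ ∨ R x b₃) (hxb : ¬ R x b₁) (hya : R a₁ y) :
    R x y := by
  have q1 := h.rotate.not_adj_of_not_adj' (x := x) h6
  have q2 := h.rotate.rotate.not_adj_of_not_adj' (x := x) h6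
  have r2 := h.not_adj_of_not_adj (y := y) h6
  obtain ⟨⟨h11, h22, h33⟩, ⟨h12, h13⟩, ⟨h21, h23⟩, ⟨h31, h32⟩⟩ := h
  have x2 : R x b₂ := by tauto
  have x3 : R x b₃ := by tauto
  by_contra hxy
  by_cases y2 : R a₂ y
  · exact h6 ⟨x, a₁, a₂, b₂, y, b₁, x2, h12, hya, y2, h21, hxy, hxb, h11, h22⟩
  · have y3 : R a₃ y := by tauto
    exact h6 ⟨x, a₁, a₃, b₃, y, b₁, x3, h13, hya, y3, h31, hxy, hxb, h11, h33⟩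

/-- If no vertex is anticomplete to one side of the six-cycle, the bipartite complement is
disconnected. -/
theorem IsInducedC6.split_of_no_total (h : IsInducedC6 R a₁ a₂ a₃ b₁ b₂ b₃)
    (h6 : ¬ HasInducedP6 R) (hy : ∀ y, R a₁ y ∨ R a₂ y ∨ R a₃ y)
    (hx : ∀ x, R x b₁ ∨ R x b₂ ∨ R x b₃) : HasUniformSplit R := by
  obtain ⟨⟨h11, -, -⟩, -, ⟨h21, -⟩, -⟩ := id h
  refine ⟨{x | ¬ R x b₁}, {y | ¬ R a₁ y}, .inl ⟨a₁, h11⟩, .inl ⟨a₂, by simpa using h21⟩,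
    True, True, ?_, ?_⟩
  · intro x hx' y hy'
    simp only [iff_true]
    exact h.adj_of_adj h6 (hx x) hx' (by simpa using hy')
  · intro x hx' y hy'
    simp only [iff_true]
    exact h.flip.adj_of_adj (fun h => h6 h.flip) (hy y) hy' (by simpa [_root_.flip] using hx')

end

section

variable {α : Type u} {β : Type v} [Finite α] [Finite β] {R : α → β → Prop}

/-- Without induced `P₆` and `C₆` there is a uniform split. -/
theorem hasUniformSplit_of_no_C6 [Nonempty α] [Nonempty β] (h6 : ¬ HasInducedP6 R)
    (hC : ∀ a₁ a₂ a₃ b₁ b₂ b₃, ¬ IsInducedC6 R a₁ a₂ a₃ b₁ b₂ b₃) : HasUniformSplit R := by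
  by_contra hns
  obtain ⟨v, hv⟩ := Finite.exists_max (fun b : β => {a | R a b}.ncard)
  have star : ∀ k k' i i', R k v → ¬ R k' v → R k i → R k' i → R k' i' → R k i' := by
    intro k k' i i' hkv hk'v hki hk'i hk'i'
    by_contra hki'
    have : ∃ p, R p v ∧ ¬ R p i := by
      by_contra! hall
      have hlt : {a | R a v}.ncard < {a | R a i}.ncard :=
        Set.ncard_lt_ncard ⟨hall, fun hsub => hk'v (hsub hk'i)⟩
      exact absurd (hv i) (not_le.2 hlt)
    obtain ⟨p, hpv, hpi⟩ := this
    by_cases hpi' : R p i'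
    · exact hC k k' p i' v i ⟨⟨hki', hk'v, hpi⟩, ⟨hkv, hki⟩, ⟨hk'i', hk'i⟩, ⟨hpi', hpv⟩⟩
    · exact h6 ⟨p, k, k', v, i, i', hpv, hkv, hki, hk'i, hk'i', hpi, hpi', hki', hk'v⟩
  have hM : ∃ m, ¬ R m v := by
    by_contra! hall
    exact hns (hasUniformSplit_of_vertex v (.inl inferInstance) True
      (fun a => by simpa using hall a))
  have hN : ∃ k, R k v := by
    by_contra! hall
    exact hns (hasUniformSplit_of_vertex v (.inl inferInstance) False
      (fun a => by simpa using hall a))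
  obtain ⟨k, hk⟩ := hN
  have : Nonempty {k // R k v} := ⟨⟨k, hk⟩⟩
  obtain ⟨⟨x, hxv⟩, hx⟩ := Finite.exists_max
    (fun k : {k // R k v} => {i | R k.1 i ∧ ∃ m, ¬ R m v ∧ R m i}.ncard)
  have hxM : ∀ m i, ¬ R m v → R m i → R x i := by
    by_contra! hcon
    obtain ⟨m, i, hmv, hmi, hxi⟩ := hcon
    have hD : ∀ m', ¬ R m' v → (∃ i, R m' i ∧ ¬ R x i) → ∀ i, R m' i → ¬ R x i :=
      fun m' hm' ⟨i₀, h1, h2⟩ i h3 h4 => h2 (star x m' i i₀ hxv hm' h4 h3 h1)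
    have hconn : ∃ k i₂ m₂, R k v ∧ R k i₂ ∧ ¬ R m₂ v ∧ R m₂ i₂ ∧ ¬ R x i₂ := by
      by_contra! hno
      refine hns ⟨{m | ¬ R m v ∧ ∃ i, R m i ∧ ¬ R x i},
        {i | ¬ R x i ∧ ∃ m, ¬ R m v ∧ R m i}, .inl ⟨m, hmv, i, hmi, hxi⟩,
        .inl ⟨x, fun h => h.1 hxv⟩, False, False, ?_, ?_⟩
      · rintro m' ⟨h1, h2⟩ i' hi'
        simp only [iff_false]
        exact fun hr => hi' ⟨hD m' h1 h2 i' hr, m', h1, hr⟩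
      · rintro m' hm' i' ⟨h1, m₂, h2, h3⟩
        simp only [iff_false]
        intro hr
        by_cases hm'v : R m' v
        · exact h1 (hno m' i' m₂ hm'v hr h2 h3)
        · exact hm' ⟨hm'v, i', hr, h1⟩
    obtain ⟨k, i₂, m₂, hkv, hki, hm₂, hmi₂, hxi₂⟩ := hconn
    have : ∃ i₁ m₁, R x i₁ ∧ ¬ R m₁ v ∧ R m₁ i₁ ∧ ¬ R k i₁ := by
      by_contra! hall
      have hlt : {i | R x i ∧ ∃ m, ¬ R m v ∧ R m i}.ncard <
          {i | R k i ∧ ∃ m, ¬ R m v ∧ R m i}.ncard :=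
        Set.ncard_lt_ncard ⟨fun i ⟨h1, m, h2, h3⟩ => ⟨hall i m h1 h2 h3, m, h2, h3⟩,
          fun hsub => hxi₂ (hsub ⟨hki, m₂, hm₂, hmi₂⟩).1⟩
      exact absurd (hx ⟨k, hkv⟩) (not_le.2 hlt)
    obtain ⟨i₁, m₁, hxi₁, hm₁, hmi₁, hki₁⟩ := this
    refine h6 ⟨m₁, x, k, i₁, v, i₂, hmi₁, hxi₁, hxv, hkv, hki, hm₁, ?_, hxi₂, hki₁⟩
    exact fun hr => hD m₁ hm₁ ⟨i₂, hr, hxi₂⟩ i₁ hmi₁ hxi₁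
  obtain ⟨m₀, hm₀⟩ := hM
  refine hns ⟨{k | R k v ∧ ∀ m i, ¬ R m v → R m i → R k i},
    {i | ∀ k, R k i → R k v ∧ ∀ m i, ¬ R m v → R m i → R k i}, .inl ⟨x, hxv, hxM⟩,
    .inl ⟨m₀, fun h => hm₀ h.1⟩, True, False, ?_, ?_⟩
  · rintro z ⟨hzv, hzM⟩ y hy
    simp only [iff_true]
    simp only [Set.mem_ofPred_eq, not_forall] at hy
    obtain ⟨k, hky, hk⟩ := hy
    by_contra hzy
    have hyM : ∀ m, ¬ R m v → ¬ R m y := fun m hm hr => hzy (hzM m y hm hr)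
    have hkv : R k v := by
      by_contra hkv
      exact hyM k hkv hky
    have : ∃ m i, ¬ R m v ∧ R m i ∧ ¬ R k i := by
      by_contra! hall
      exact hk ⟨hkv, hall⟩
    obtain ⟨m, i, hmv, hmi, hki⟩ := this
    exact h6 ⟨m, z, k, i, v, y, hmi, hzM m i hmv hmi, hzv, hkv, hky, hmv, hyM m hmv, hzy, hki⟩
  · intro k hk i hi
    simp only [iff_false]
    exact fun hr => hk (hi k hr)

end

theorem hasUniformSplit_of_no_P6_aux (n : ℕ) :
    ∀ {α β : Type u} [Finite α] [Finite β] (R : α → β → Prop), Nat.card α + Nat.card β = n →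
      2 ≤ n → ¬ HasInducedP6 R → HasUniformSplit R := by
  induction n using Nat.strong_induction_on with
  | _ n ih =>
  intro α β _ _ R hn h2 h6
  rcases isEmpty_or_nonempty α with hα | hα
  · have h0 : Nat.card α = 0 := Nat.card_of_isEmpty
    have : Nontrivial β := Finite.one_lt_card_iff_nontrivial.1 (by omega)
    obtain ⟨b, b', hb⟩ := exists_pair_ne β
    exact hasUniformSplit_of_vertex b (.inr ⟨b', hb.symm⟩) True (fun a => isEmptyElim a)
  rcases isEmpty_or_nonempty β with hβ | hβ
  · have h0 : Nat.card β = 0 := Nat.card_of_isEmpty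
    have : Nontrivial α := Finite.one_lt_card_iff_nontrivial.1 (by omega)
    obtain ⟨b, b', hb⟩ := exists_pair_ne α
    exact (hasUniformSplit_of_vertex (R := flip R) b (.inr ⟨b', hb.symm⟩) True
      (fun a => isEmptyElim a)).flip
  by_contra hns
  by_cases hC : ∀ a₁ a₂ a₃ b₁ b₂ b₃, ¬ IsInducedC6 R a₁ a₂ a₃ b₁ b₂ b₃
  · exact hns (hasUniformSplit_of_no_C6 h6 hC)
  push Not at hC
  obtain ⟨a₁, a₂, a₃, b₁, b₂, b₃, hC⟩ := hC
  have cut : ∀ {α β : Type u} [Finite α] [Finite β] (R : α → β → Prop),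
      Nat.card α + Nat.card β = n → ¬ HasInducedP6 R → ¬ HasUniformSplit R →
      ∀ {a₁ a₂ a₃ : α} {b₁ b₂ b₃ : β}, IsInducedC6 R a₁ a₂ a₃ b₁ b₂ b₃ → IsComplCut R a₁ := by
    intro α β _ _ R hn h6 hns a₁ a₂ a₃ b₁ b₂ b₃ hC
    refine (hC.split_of_split_delete h6 ?_).resolve_left hns
    have hlt : Nat.card {x : α // x ≠ a₁} < Nat.card α :=
      Finite.card_subtype_lt (x := a₁) (by simp)
    have ha : 0 < Nat.card {x : α // x ≠ a₁} := by
      have : Nonempty {x : α // x ≠ a₁} := ⟨a₂, by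
        rintro rfl
        exact hC.1.1 hC.2.2.1.1⟩
      exact Nat.card_pos
    have hb : 0 < Nat.card β := by
      have : Nonempty β := ⟨b₁⟩
      exact Nat.card_pos
    refine ih _ (by omega) _ rfl (by omega) ?_
    rintro ⟨x₁, x₂, x₃, y₁, y₂, y₃, h⟩
    exact h6 ⟨x₁, x₂, x₃, y₁, y₂, y₃, h⟩
  have h6' : ¬ HasInducedP6 (flip R) := fun h => h6 h.flip
  have hns' : ¬ HasUniformSplit (flip R) := fun h => hns h.flip
  have hn' : Nat.card β + Nat.card α = n := by omega
  by_cases hy : ∀ y, R a₁ y ∨ R a₂ y ∨ R a₃ y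
  · by_cases hx : ∀ x, R x b₁ ∨ R x b₂ ∨ R x b₃
    · exact hns (hC.split_of_no_total h6 hy hx)
    · push Not at hx
      obtain ⟨x, x1, x2, x3⟩ := hx
      exact hns' (hC.flip.split_of_cuts h6' x1 x2 x3 (cut R hn h6 hns hC)
        (cut R hn h6 hns hC.rotate))
  · push Not at hy
    obtain ⟨y, y1, y2, y3⟩ := hy
    exact hns (hC.split_of_cuts h6 y1 y2 y3 (cut (flip R) hn' h6' hns' hC.flip)
      (cut (flip R) hn' h6' hns' hC.rotate.flip))

/-- Every bipartite graph on at least two vertices without induced `P₆` has a uniform split. -/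
theorem hasUniformSplit_of_no_P6 {α β : Type u} [Finite α] [Finite β] {R : α → β → Prop}
    (h2 : 2 ≤ Nat.card α + Nat.card β) (h6 : ¬ HasInducedP6 R) : HasUniformSplit R :=
  hasUniformSplit_of_no_P6_aux _ R rfl h2 h6

/-- A map that preserves and reflects adjacency is an embedding if the domain has no twins. -/
theorem isIndContained_of_adj_iff {W : Type v} {V : Type u} {H : SimpleGraph W}
    {G : SimpleGraph V} (hH : ∀ x y, (∀ z, H.Adj x z ↔ H.Adj y z) → x = y) (f : W → V)
    (hf : ∀ x y, G.Adj (f x) (f y) ↔ H.Adj x y) : H.IsIndContained G :=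
  ⟨⟨⟨f, fun x y hxy => hH x y fun z => by rw [← hf, ← hf, hxy]⟩, fun {x y} => hf x y⟩⟩

theorem bullPlusP1_adj (x y : Fin 5 ⊕ Fin 1) : bullPlusP1.Adj x y ↔
    (x, y) ∈ ({(.inl 0, .inl 1), (.inl 1, .inl 0), (.inl 1, .inl 2), (.inl 2, .inl 1),
      (.inl 2, .inl 0), (.inl 0, .inl 2), (.inl 0, .inl 3), (.inl 3, .inl 0),
      (.inl 1, .inl 4), (.inl 4, .inl 1)} :
      Finset ((Fin 5 ⊕ Fin 1) × (Fin 5 ⊕ Fin 1))) := by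
  rcases x with x | x <;> rcases y with y | y <;> fin_cases x <;> fin_cases y <;>
    simp [bullPlusP1, bull]

theorem graphQ_adj (x y : Fin 6) : graphQ.Adj x y ↔
    (x, y) ∈ [((0 : Fin 6), (1 : Fin 6)), (1, 0), (1, 2), (2, 1), (2, 0), (0, 2), (0, 3), (3, 0),
      (1, 3), (3, 1), (1, 4), (4, 1), (2, 5), (5, 2)] := by
  fin_cases x <;> fin_cases y <;> simp [graphQ]

namespace IsSplitPartition

variable {V : Type u} {G : SimpleGraph V} {K I : Set V}

theorem mem_left_iff (h : IsSplitPartition G K I) (x : V) : x ∈ K ↔ x ∉ I := by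
  rw [← h.1.compl_eq, Set.notMem_compl_iff]

theorem adj_of_mem (h : IsSplitPartition G K I) {x y : V} (hx : x ∈ K) (hy : y ∈ K)
    (hxy : x ≠ y) : G.Adj x y :=
  h.2.1 hx hy hxy

theorem not_adj_of_mem (h : IsSplitPartition G K I) {x y : V} (hx : x ∈ I) (hy : y ∈ I) :
    ¬ G.Adj x y :=
  fun hxy => h.2.2 hx hy hxy.ne hxy

theorem bullPlusP1_isIndContained (h : IsSplitPartition G K I) {a b c d e p : V} (ha : a ∈ K)
    (hb : b ∈ K) (hc : c ∈ I) (hd : d ∈ I) (he : e ∈ I) (hp : p ∈ I) (hac : G.Adj a c)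
    (hbc : G.Adj b c) (had : G.Adj a d) (hbd : ¬ G.Adj b d) (hae : ¬ G.Adj a e)
    (hbe : G.Adj b e) (hap : ¬ G.Adj a p) (hbp : ¬ G.Adj b p) :
    bullPlusP1.IsIndContained G := by
  have hab : G.Adj a b := h.adj_of_mem ha hb (by
    rintro rfl
    exact hbd had)
  refine isIndContained_of_adj_iff ?_ (Sum.elim ![a, b, c, d, e] ![p]) ?_
  · simp only [bullPlusP1_adj]
    decide
  · have hI : ∀ x ∈ I, ∀ y ∈ I, ¬ G.Adj x y := fun x hx y hy => h.not_adj_of_mem hx hy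
    intro x y
    rw [bullPlusP1_adj]
    rcases x with x | x <;> rcases y with y | y <;> fin_cases x <;> fin_cases y <;>
      simp [*, hab.symm, G.adj_comm c a, G.adj_comm c b, G.adj_comm d a, G.adj_comm d b,
        G.adj_comm e a, G.adj_comm e b, G.adj_comm p a, G.adj_comm p b]

theorem graphQ_isIndContained (h : IsSplitPartition G K I) {a b c d e f : V} (ha : a ∈ K)
    (hb : b ∈ K) (hc : c ∈ K) (hd : d ∈ I) (he : e ∈ I) (hf : f ∈ I) (had : G.Adj a d)
    (hae : ¬ G.Adj a e) (haf : ¬ G.Adj a f) (hbd : G.Adj b d) (hbe : G.Adj b e)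
    (hbf : ¬ G.Adj b f) (hcd : ¬ G.Adj c d) (hce : ¬ G.Adj c e) (hcf : G.Adj c f) :
    graphQ.IsIndContained G := by
  have hab : G.Adj a b := h.adj_of_mem ha hb (by
    rintro rfl
    exact hae hbe)
  have hac : G.Adj a c := h.adj_of_mem ha hc (by
    rintro rfl
    exact haf hcf)
  have hbc : G.Adj b c := h.adj_of_mem hb hc (by
    rintro rfl
    exact hbf hcf)
  refine isIndContained_of_adj_iff ?_ ![a, b, c, d, e, f] ?_
  · simp only [graphQ_adj]
    decide
  · have hI : ∀ x ∈ I, ∀ y ∈ I, ¬ G.Adj x y := fun x hx y hy => h.not_adj_of_mem hx hy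
    intro x y
    rw [graphQ_adj]
    fin_cases x <;> fin_cases y <;>
      simp [*, hab.symm, hac.symm, hbc.symm, G.adj_comm d a, G.adj_comm d b, G.adj_comm d c,
        G.adj_comm e a, G.adj_comm e b, G.adj_comm e c, G.adj_comm f a, G.adj_comm f b,
        G.adj_comm f c]

/-- The labelling of the bipartite graph `G'` with black class `I`. -/
theorem exists_labelling (h : IsSplitPartition G K I) :
    ∃ m : BWLabelling (subgraphComplement G K), ∀ x, m x = true ↔ x ∈ I := by
  classical
  refine ⟨SimpleGraph.Coloring.mk (fun x => decide (x ∈ I)) ?_, fun x => decide_eq_true_iff⟩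
  rintro x y ⟨hne, hxy⟩ heq
  rw [decide_eq_decide] at heq
  by_cases hx : x ∈ I
  · have hy := heq.1 hx
    rcases hxy with hxy | hxy
    · exact (h.mem_left_iff x).1 hxy.1 hx
    · exact h.not_adj_of_mem hx hy hxy.2
  · have hxK := (h.mem_left_iff x).2 hx
    have hyK := (h.mem_left_iff y).2 (fun hy => hx (heq.2 hy))
    rcases hxy with hxy | hxy
    · exact hxy.2.2 (h.adj_of_mem hxK hyK hne)
    · exact hxy.1 ⟨hxK, hyK⟩

theorem isBipartite_subgraphComplement (h : IsSplitPartition G K I) :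
    (subgraphComplement G K).IsBipartite := by
  obtain ⟨m, -⟩ := h.exists_labelling
  simpa using m.colorable

theorem subgraphComplement_adj (h : IsSplitPartition G K I) {x y : V} (hy : y ∈ I) :
    (subgraphComplement G K).Adj x y ↔ G.Adj x y := by
  have hyK : y ∉ K := fun hyK => (h.mem_left_iff y).1 hyK hy
  constructor
  · rintro ⟨-, hxy | hxy⟩
    · exact absurd hxy.2.1 hyK
    · exact hxy.2
  · exact fun hxy => ⟨hxy.ne, .inr ⟨fun h => hyK h.2, hxy⟩⟩

theorem isWeaklyFree_labellingP1P5 (h : IsSplitPartition G K I)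
    (hG : IsInducedFree bullPlusP1 G) :
    IsWeaklyFree labellingP1P5 (subgraphComplement G K) := by
  obtain ⟨m, hm⟩ := h.exists_labelling
  refine ⟨m, ?_⟩
  rintro ⟨f, hf⟩
  have hI : ∀ w, labellingP1P5 w = true → f w ∈ I := fun w hw => (hm _).1 ((hf w).trans hw)
  have hK : ∀ w, labellingP1P5 w = false → f w ∈ K := fun w hw =>
    (h.mem_left_iff _).2 fun hI => by
      have := (hm _).2 hI
      rw [hf, hw] at this
      exact absurd this (by decide)
  have hadj : ∀ w z, labellingP1P5 z = true → (G.Adj (f w) (f z) ↔ graphP1P5.Adj w z) :=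
    fun w z hz => (h.subgraphComplement_adj (hI z hz)).symm.trans f.map_adj_iff
  refine hG (h.bullPlusP1_isIndContained (a := f (.inr 1)) (b := f (.inr 3)) (c := f (.inr 2))
    (d := f (.inr 0)) (e := f (.inr 4)) (p := f (.inl 0)) (hK _ rfl) (hK _ rfl) (hI _ rfl)
    (hI _ rfl) (hI _ rfl) (hI _ rfl) ?_ ?_ ?_ ?_ ?_ ?_ ?_ ?_) <;> rw [hadj _ _ rfl] <;>
    simp [SimpleGraph.pathGraph_adj]

theorem isWeaklyFree_labellingP2P4 (h : IsSplitPartition G K I)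
    (hG : IsInducedFree graphQ G) :
    IsWeaklyFree labellingP2P4 (subgraphComplement G K) := by
  obtain ⟨m, hm⟩ := h.exists_labelling
  refine ⟨m, ?_⟩
  rintro ⟨f, hf⟩
  have hI : ∀ w, labellingP2P4 w = true → f w ∈ I := fun w hw => (hm _).1 ((hf w).trans hw)
  have hK : ∀ w, labellingP2P4 w = false → f w ∈ K := fun w hw =>
    (h.mem_left_iff _).2 fun hI => by
      have := (hm _).2 hI
      rw [hf, hw] at this
      exact absurd this (by decide)
  have hadj : ∀ w z, labellingP2P4 z = true → (G.Adj (f w) (f z) ↔ graphP2P4.Adj w z) :=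
    fun w z hz => (h.subgraphComplement_adj (hI z hz)).symm.trans f.map_adj_iff
  refine hG (h.graphQ_isIndContained (a := f (.inr 3)) (b := f (.inr 1)) (c := f (.inl 1))
    (d := f (.inr 2)) (e := f (.inr 0)) (f := f (.inl 0)) (hK _ rfl) (hK _ rfl) (hK _ rfl)
    (hI _ rfl) (hI _ rfl) (hI _ rfl) ?_ ?_ ?_ ?_ ?_ ?_ ?_ ?_ ?_) <;> rw [hadj _ _ rfl] <;>
    simp [SimpleGraph.pathGraph_adj]

theorem hasColourSplit_of_graphQ_free [Finite V] (h : IsSplitPartition G K I)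
    (hG : IsInducedFree graphQ G) (c : V → Fin 2) (hc : ∀ x, c x = 0 ↔ x ∈ I) (U : Set V)
    (hU : U.Nontrivial) : HasColourSplit G c U := by
  have hcK : ∀ x ∈ K, c x ≠ 0 := fun x hx h0 => (h.mem_left_iff x).1 hx ((hc x).1 h0)
  have hsplit : HasUniformSplit (fun (x : ↥(U ∩ K)) (y : ↥(U ∩ I)) => ¬ G.Adj (x : V) y) := by
    refine hasUniformSplit_of_no_P6 ?_ ?_
    · have h1 : U ∩ K ∪ U ∩ I = U := by
        have hKI : K ∪ I = Set.univ := h.1.sup_eq_top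
        rw [← Set.inter_union_distrib_left, hKI, Set.inter_univ]
      have h2 : Disjoint (U ∩ K) (U ∩ I) :=
        h.1.disjoint.mono Set.inter_subset_right Set.inter_subset_right
      have h3 := Set.ncard_union_eq h2
      rw [h1] at h3
      have h4 := Set.one_lt_ncard_iff_nontrivial.2 hU
      rw [Nat.card_coe_set_eq, Nat.card_coe_set_eq]
      omega
    · rintro ⟨b, a, c, f, e, d, h1, h2, h3, h4, h5, h6, h7, h8, h9⟩
      simp only [not_not] at h6 h7 h8 h9
      exact hG (h.graphQ_isIndContained a.2.2 b.2.2 c.2.2 d.2.2 e.2.2 f.2.2 h8 h3 h2 h7 h6 h1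
        h5 h4 h9)
  obtain ⟨A, B, hA, hB, p, q, hp, hq⟩ := hsplit
  refine ⟨Subtype.val '' A ∪ Subtype.val '' B, Subtype.val '' Aᶜ ∪ Subtype.val '' Bᶜ, ?_, ?_,
    ?_, ?_, fun i j => (i ≠ 0 ∧ j ≠ 0) ∨ (i ≠ 0 ∧ j = 0 ∧ ¬ p) ∨ (i = 0 ∧ j ≠ 0 ∧ ¬ q), ?_⟩
  · rcases hA with ⟨x, hx⟩ | ⟨x, hx⟩
    · exact ⟨x, .inl ⟨x, hx, rfl⟩⟩
    · exact ⟨x, .inr ⟨x, hx, rfl⟩⟩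
  · rcases hB with ⟨x, hx⟩ | ⟨x, hx⟩
    · exact ⟨x, .inl ⟨x, hx, rfl⟩⟩
    · exact ⟨x, .inr ⟨x, hx, rfl⟩⟩
  · rw [Set.disjoint_left]
    rintro _ (⟨x, hx, rfl⟩ | ⟨x, hx, rfl⟩) (⟨y, hy, hxy⟩ | ⟨y, hy, hxy⟩)
    · exact hy (Subtype.ext hxy ▸ hx)
    · exact (h.mem_left_iff x).1 x.2.2 (hxy ▸ y.2.2)
    · exact (h.mem_left_iff x).1 (hxy ▸ y.2.2) x.2.2
    · exact hy (Subtype.ext hxy ▸ hx)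
  · ext x
    constructor
    · rintro ((⟨x, -, rfl⟩ | ⟨x, -, rfl⟩) | (⟨x, -, rfl⟩ | ⟨x, -, rfl⟩)) <;> exact x.2.1
    · intro hx
      by_cases hxI : x ∈ I
      · by_cases hxB : ⟨x, hx, hxI⟩ ∈ B
        · exact .inl (.inr ⟨_, hxB, rfl⟩)
        · exact .inr (.inr ⟨_, hxB, rfl⟩)
      · have hxK := (h.mem_left_iff x).2 hxI
        by_cases hxA : ⟨x, hx, hxK⟩ ∈ A
        · exact .inl (.inl ⟨_, hxA, rfl⟩)
        · exact .inr (.inl ⟨_, hxA, rfl⟩)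
  · rintro _ (⟨x, hx, rfl⟩ | ⟨x, hx, rfl⟩) _ (⟨y, hy, rfl⟩ | ⟨y, hy, rfl⟩)
    · have h1 := hcK x x.2.2
      have h2 := hcK y y.2.2
      have h3 := h.adj_of_mem x.2.2 y.2.2 (fun hxy => hy (Subtype.ext hxy ▸ hx))
      tauto
    · have h1 := hcK x x.2.2
      have h2 := (hc y).2 y.2.2
      have h3 := hp x hx y hy
      tauto
    · have h1 := (hc x).2 x.2.2
      have h2 := hcK y y.2.2
      have h3 := hq y hy x hx
      have h4 := G.adj_comm x y
      tauto
    · have h1 := (hc x).2 x.2.2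
      have h2 := (hc y).2 y.2.2
      have h3 := h.not_adj_of_mem x.2.2 y.2.2
      tauto

/-- If the neighbourhoods in `I`, complemented for the vertices of `K` of colour other than `1`,
form a laminar family, then every nontrivial vertex set has a colour split. -/
theorem hasColourSplit_of_laminar [Finite V] (h : IsSplitPartition G K I) (c : V → Fin 3)
    (hc : ∀ x, c x = 0 ↔ x ∈ I) (S : V → Set V)  (hS : ∀ w ∈ K, ∀ x ∈ I, (G.Adj w x ↔ (x ∈ S w ↔ c w = 1)))
    (hlam : ∀ w ∈ K, ∀ w' ∈ K, Disjoint (S w) (S w') ∨ S w ⊆ S w' ∨ S w' ⊆ S w) (U : Set V)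
    (hU : U.Nontrivial) : HasColourSplit G c U := by
  have hcK : ∀ x ∈ K, c x ≠ 0 := fun x hx h0 => (h.mem_left_iff x).1 hx ((hc x).1 h0)
  have split : ∀ A ⊆ U, A.Nonempty → (U \ A).Nonempty → (∃ J : Fin 3 → Fin 3 → Prop,
      ∀ x ∈ A, ∀ y ∈ U \ A, G.Adj x y ↔ J (c x) (c y)) → HasColourSplit G c U :=
    fun A hAU hA hB hJ => ⟨A, U \ A, hA, hB, Set.disjoint_sdiff_right,
      Set.union_sdiff_cancel hAU, hJ⟩
  by_cases hUK : (U ∩ K).Nonempty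
  · obtain ⟨w, ⟨hwU, hwK⟩, hw⟩ := Set.exists_max_image (U ∩ K) (fun w => (S w ∩ U).ncard)
      (Set.toFinite _) hUK
    by_cases hall : U ∩ I ⊆ S w
    · refine split {w} (by simpa using hwU) ⟨w, rfl⟩ ?_ ⟨fun i j => j ≠ 0 ∨ i = 1, ?_⟩
      · obtain ⟨x, hx, hxw⟩ := hU.exists_ne w
        exact ⟨x, hx, hxw⟩
      · rintro _ rfl y ⟨hyU, hyw⟩
        by_cases hyI : y ∈ I
        · have h1 := hS _ hwK y hyI
          have h2 := hall ⟨hyU, hyI⟩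
          have h3 := (hc y).2 hyI
          tauto
        · have hyK := (h.mem_left_iff y).2 hyI
          have h1 := hcK y hyK
          have h2 := h.adj_of_mem hwK hyK (fun h => hyw h.symm)
          tauto
    · obtain ⟨z, ⟨hzU, hzI⟩, hzw⟩ := Set.not_subset.1 hall
      refine split {x | x ∈ U ∧ (x ∈ I ∧ x ∈ S w ∨ x ∈ K ∧ S x ∩ U ⊆ S w)} (fun x hx => hx.1)
        ⟨w, hwU, .inr ⟨hwK, Set.inter_subset_left⟩⟩ ⟨z, hzU, ?_⟩
        ⟨fun i j => (i ≠ 0 ∧ j ≠ 0) ∨ (i = 0 ∧ j ≠ 0 ∧ j ≠ 1) ∨ (i ≠ 0 ∧ j = 0 ∧ i ≠ 1), ?_⟩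
      · rintro ⟨-, hz | hz⟩
        · exact hzw hz.2
        · exact (h.mem_left_iff z).1 hz.1 hzI
      · rintro x ⟨hxU, hx⟩ y ⟨hyU, hy⟩
        have hxy : x ≠ y := by
          rintro rfl
          exact hy ⟨hxU, hx⟩
        by_cases hyI : y ∈ I
        · have hy0 := (hc y).2 hyI
          rcases hx with ⟨hxI, -⟩ | ⟨hxK, hxS⟩
          · have h1 := (hc x).2 hxI
            have h2 := h.not_adj_of_mem hxI hyI
            tauto
          · have h1 := hcK x hxK
            have h2 := hS x hxK y hyI
            have h3 : y ∉ S x := fun hyS => hy ⟨hyU, .inl ⟨hyI, hxS ⟨hyS, hyU⟩⟩⟩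
            tauto
        · have hyK := (h.mem_left_iff y).2 hyI
          have hy0 := hcK y hyK
          rcases hx with ⟨hxI, hxS⟩ | ⟨hxK, -⟩
          · have h1 := (hc x).2 hxI
            have h2 := hS y hyK x hxI
            have hyS : ¬ S y ∩ U ⊆ S w := fun hyS => hy ⟨hyU, .inr ⟨hyK, hyS⟩⟩
            have h3 : x ∉ S y := by
              intro hxy
              rcases hlam w hwK y hyK with hd | hd | hd
              · exact Set.disjoint_left.1 hd hxS hxy
              · have hlt : (S w ∩ U).ncard < (S y ∩ U).ncard :=
                  Set.ncard_lt_ncard ⟨Set.inter_subset_inter_left U hd,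
                    fun hsub => hyS fun t ht => (hsub ht).1⟩
                exact absurd (hw y ⟨hyU, hyK⟩) (not_le.2 hlt)
              · exact hyS fun t ht => hd ht.1
            rw [G.adj_comm] at h2
            tauto
          · have h1 := hcK x hxK
            have h2 := h.adj_of_mem hxK hyK hxy
            tauto
  · have hUI : U ⊆ I := fun x hx => by
      by_contra hxI
      exact hUK ⟨x, hx, (h.mem_left_iff x).2 hxI⟩
    obtain ⟨x, hx, y, hy, hxy⟩ := hU
    refine split {x} (by simpa using hx) ⟨x, rfl⟩ ⟨y, hy, fun h => hxy h.symm⟩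
      ⟨fun _ _ => False, ?_⟩
    rintro _ rfl z ⟨hz, -⟩
    exact iff_false_intro (h.not_adj_of_mem (hUI hx) (hUI hz))

theorem cliqueWidth_le_of_graphQ_free [Finite V] (h : IsSplitPartition G K I)
    (hG : IsInducedFree graphQ G) : cliqueWidth G ≤ (4 : ℕ) := by
  classical
  refine cliqueWidth_le_of_hasColourSplit (k := 2) G (fun x => if x ∈ I then 0 else 1)
    (h.hasColourSplit_of_graphQ_free hG _ fun x => ?_)
  by_cases hx : x ∈ I <;> simp [hx]

theorem cliqueWidth_le_of_bullPlusP1_free [Finite V] (h : IsSplitPartition G K I)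
    (hG : IsInducedFree bullPlusP1 G) : cliqueWidth G ≤ (6 : ℕ) := by
  classical
  -- the element `r` of `I` that all the switched neighbourhoods avoid
  obtain ⟨r, hr⟩ : ∃ r : Option V, ∀ x ∈ I, ∃ r' ∈ I, r = some r' := by
    rcases I.eq_empty_or_nonempty with rfl | ⟨r, hr⟩
    · exact ⟨none, fun x hx => hx.elim⟩
    · exact ⟨some r, fun _ _ => ⟨r, hr, rfl⟩⟩
  let P : V → Prop := fun w => ∃ r', r = some r' ∧ G.Adj w r'
  let c : V → Fin 3 := fun x => if x ∈ I then 0 else if P x then 2 else 1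
  have hc0 : ∀ x, c x = 0 ↔ x ∈ I := by
    intro x
    by_cases hx : x ∈ I <;> by_cases hx' : P x <;> simp [c, hx, hx']
  have hc1 : ∀ x ∈ K, (c x = 1 ↔ ¬ P x) := by
    intro x hx
    have := (h.mem_left_iff x).1 hx
    by_cases hx' : P x <;> simp [c, this, hx']
  refine cliqueWidth_le_of_hasColourSplit (k := 3) G c
    (h.hasColourSplit_of_laminar c hc0 (fun w => {x | x ∈ I ∧ (G.Adj w x ↔ ¬ P w)})
      (fun w hw x hx => ?_) (fun w hw w' hw' => ?_))
  · have h1 := hc1 w hw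
    rw [Set.mem_ofPred_eq, h1]
    by_cases p : P w <;> by_cases q : G.Adj w x <;> simp [p, q, hx]
  · by_contra! hcon
    obtain ⟨h1, h2, h3⟩ := hcon
    obtain ⟨x, ⟨hx, x1⟩, -, x2⟩ := Set.not_disjoint_iff.1 h1
    obtain ⟨y, ⟨hy, y1⟩, y2⟩ := Set.not_subset.1 h2
    obtain ⟨z, ⟨hz, z1⟩, z2⟩ := Set.not_subset.1 h3
    obtain ⟨r, hrI, rfl⟩ := hr x hx
    have hP : ∀ w, P w ↔ G.Adj w r := fun w => by simp [P]
    have y2' : ¬ (G.Adj w' y ↔ ¬ P w') := fun h => y2 ⟨hy, h⟩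
    have z2' : ¬ (G.Adj w z ↔ ¬ P w) := fun h => z2 ⟨hz, h⟩
    rw [hP] at x1 x2 y1 y2' z1 z2'
    apply hG
    by_cases p : G.Adj w r <;> by_cases p' : G.Adj w' r <;>
      simp only [p, p', not_true, not_false_iff, iff_true, iff_false, not_not] at x1 x2 y1 y2' z1 z2'
    · exact h.bullPlusP1_isIndContained (c := r) (d := z) (e := y) (p := x) hw hw' hrI hz hy hx
        ‹_› ‹_› ‹_› ‹_› ‹_› ‹_› ‹_› ‹_›
    · exact h.bullPlusP1_isIndContained (c := z) (d := r) (e := x) (p := y) hw hw' hz hrI hx hy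
        ‹_› ‹_› ‹_› ‹_› ‹_› ‹_› ‹_› ‹_›
    · exact h.bullPlusP1_isIndContained (c := y) (d := x) (e := r) (p := z) hw hw' hy hx hrI hz
        ‹_› ‹_› ‹_› ‹_› ‹_› ‹_› ‹_› ‹_›
    · exact h.bullPlusP1_isIndContained (c := x) (d := y) (e := z) (p := r) hw hw' hx hy hz hrI
        ‹_› ‹_› ‹_› ‹_› ‹_› ‹_› ‹_› ‹_›

end IsSplitPartition

theorem theorem6 :
    HasBoundedCliqueWidth.{u} (fun _ G => IsSplitGraph G ∧ IsInducedFree bullPlusP1 G) ∧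
    HasBoundedCliqueWidth.{u} (fun _ G => IsSplitGraph G ∧ IsInducedFree graphQ G) ∧
    (∀ (V : Type u) [Finite V] (G : SimpleGraph V) (K I : Set V),
      IsSplitPartition G K I → IsInducedFree bullPlusP1 G →
        (subgraphComplement G K).IsBipartite ∧
          IsWeaklyFree labellingP1P5 (subgraphComplement G K)) ∧
    (∀ (V : Type u) [Finite V] (G : SimpleGraph V) (K I : Set V),
      IsSplitPartition G K I → IsInducedFree graphQ G →
        (subgraphComplement G K).IsBipartite ∧
          IsWeaklyFree labellingP2P4 (subgraphComplement G K)) := by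
  refine ⟨⟨6, ?_⟩, ⟨4, ?_⟩, ?_, ?_⟩
  · rintro V _ G ⟨⟨K, I, h⟩, hG⟩
    exact h.cliqueWidth_le_of_bullPlusP1_free hG
  · rintro V _ G ⟨⟨K, I, h⟩, hG⟩
    exact h.cliqueWidth_le_of_graphQ_free hG
  · exact fun V _ G K I h hG =>
      ⟨h.isBipartite_subgraphComplement, h.isWeaklyFree_labellingP1P5 hG⟩
  · exact fun V _ G K I h hG =>
      ⟨h.isBipartite_subgraphComplement, h.isWeaklyFree_labellingP2P4 hG⟩
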